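/- Let $\mathbb D=\{|z|<1\}$, let $H^2$ be the Hardy space of $\mathbb D$ (identified with its boundary functions, with inner product $\langle f,k\rangle=\frac1{2\pi}\int_0^{2\pi}f(e^{i\theta})\overline{k(e^{i\theta})}\,d\theta$), and let $H^\infty$ be the algebra of bounded analytic functions on $\mathbb D$. The Smirnov class $N^+$ consists of the functions $u/v$ on $\mathbb D$ with $u,v\in H^\infty$ and $v$ outer, and $N^+_{\mathbb R}$ is the set of $g\in N^+$ whose radial boundary values are real almost everywhere on the unit circle. Each $g\in N^+$ has a unique representation $g=b/a$ with $a,b\in H^\infty$, $a$ outer, $a(0)>0$ and $|a(e^{i\theta})|^2+|b(e^{i\theta})|^2=1$ for almost every $\theta$; the Toeplitz operator $T_g$ is the operator $T_gf=gf$ in $H^2$ with domain $\mathscr D(T_g)=aH^2$. For a complex separable Hilbert space $\mathcal H$, let $\mathcal S_1(\mathcal H)$ be the set of linear operators $T:\mathscr D(T)\subset\mathcal H\to\mathcal H$ that are densely defined, closed, symmetric ($\langle Tx,y\rangle=\langle x,Ty\rangle$ for $x,y\in\mathscr D(T)$), simple ($\bigcap_{\operatorname{Im}\lambda\neq0}\operatorname{Rng}(T-\lambda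 I)=\{0\}$) and have deficiency indices $(1,1)$, that is, $\dim\operatorname{Rng}(T-iI)^\perp=\dim\operatorname{Rng}(T+iI)^\perp=1$. **Theorem.** Let $g,h\in N^+_{\mathbb R}$ be such that $T_g,T_h\in\mathcal S_1(H^2)$. Then $T_g$ and $T_h$ are unitarily equivalent (there is a unitary operator $U$ on $H^2$ with $U\mathscr D(T_g)=\mathscr D(T_h)$ and $UT_g=T_hU$ on $\mathscr D(T_g)$) if and only if there is a disk automorphism $w$ (an analytic bijection of $\mathbb D$ onto itself) such that $g=h\circ w$ on $\mathbb D$. -/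

import Mathlib

open MeasureTheory Filter Topology Metric

namespace HardyToeplitz

/-! ### The Hardy space of the unit disk -/

/-- `L²` of the unit circle for normalised arc length, the circle being parametrised by
`t ↦ exp (2πit)`, `t ∈ ℝ/ℤ`. -/
abbrev CircleL2 : Type := Lp ℂ 2 (AddCircle.haarAddCircle (T := (1 : ℝ)))

/-- The Hardy space `H²`, through its boundary values: the functions in `L²` of the circle whose
Fourier coefficients of negative index vanish, with the inner product of `L²`. -/
noncomputable def H2 : Submodule ℂ CircleL2 where
  carrier := {f | ∀ n : ℤ, n < 0 → fourierCoeff f n = 0}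
  zero_mem' := fun n _ => by rw [← fourierBasis_repr]; simp
  add_mem' := fun {f g} hf hg n hn => by
    have h1 := hf n hn
    have h2 := hg n hn
    rw [← fourierBasis_repr] at h1 h2 ⊢
    rw [map_add]
    simp [h1, h2]
  smul_mem' := fun c f hf n hn => by
    have h1 := hf n hn
    rw [← fourierBasis_repr] at h1 ⊢
    rw [map_smul]
    simp [h1]

/-- The analytic function on the unit disk with boundary values `f`. -/
noncomputable def diskFun (f : H2) (z : ℂ) : ℂ :=
  ∑' n : ℕ, fourierCoeff (f : CircleL2) (n : ℤ) * z ^ n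

theorem norm_coeff_le (f : H2) (n : ℤ) : ‖fourierCoeff (f : CircleL2) n‖ ≤ ‖f‖ := by
  rw [← fourierBasis_repr]
  refine (lp.norm_apply_le_norm (by simp) _ n).trans ?_
  simp

theorem summable_diskFun (f : H2) {z : ℂ} (hz : z ∈ ball (0 : ℂ) 1) :
    Summable fun n : ℕ => fourierCoeff (f : CircleL2) (n : ℤ) * z ^ n := by
  have hz' : ‖z‖ < 1 := by simpa using hz
  refine Summable.of_norm_bounded (g := fun n : ℕ => ‖f‖ * ‖z‖ ^ n)
    ((summable_geometric_of_lt_one (norm_nonneg z) hz').mul_left _) fun n => ?_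
  rw [norm_mul, norm_pow]
  exact mul_le_mul_of_nonneg_right (norm_coeff_le f n) (by positivity)

theorem diskFun_add (f g : H2) {z : ℂ} (hz : z ∈ ball (0 : ℂ) 1) :
    diskFun (f + g) z = diskFun f z + diskFun g z := by
  unfold diskFun
  rw [← (summable_diskFun f hz).tsum_add (summable_diskFun g hz)]
  refine tsum_congr fun n => ?_
  simp only [← fourierBasis_repr, Submodule.coe_add, map_add, lp.coeFn_add, Pi.add_apply]
  ring

theorem diskFun_smul (c : ℂ) (f : H2) (z : ℂ) : diskFun (c • f) z = c * diskFun f z := by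
  unfold diskFun
  rw [← tsum_mul_left]
  refine tsum_congr fun n => ?_
  simp only [← fourierBasis_repr, Submodule.coe_smul, map_smul, lp.coeFn_smul, Pi.smul_apply,
    smul_eq_mul]
  ring

theorem diskFun_zero (z : ℂ) : diskFun (0 : H2) z = 0 := by
  have := diskFun_smul 0 0 z
  simpa using this

theorem eq_zero_of_diskFun (f : H2) (hf : ∀ z ∈ ball (0 : ℂ) 1, diskFun f z = 0) : f = 0 := by
  have hcoeff : ∀ n : ℕ, fourierCoeff (f : CircleL2) (n : ℤ) = 0 := by
    have hps : HasFPowerSeriesOnBall (diskFun f)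
        (FormalMultilinearSeries.ofScalars ℂ
          fun n : ℕ => fourierCoeff (f : CircleL2) (n : ℤ)) 0 1 := by
      refine ⟨?_, one_pos, fun {y} hy => ?_⟩
      · refine ENNReal.le_of_forall_nnreal_lt fun r hr => ?_
        refine FormalMultilinearSeries.le_radius_of_bound _ ‖f‖ fun n => ?_
        have hr1 : (r : ℝ) ≤ 1 := by exact_mod_cast hr.le
        rw [FormalMultilinearSeries.ofScalars_norm]
        calc _ ≤ ‖f‖ * 1 := mul_le_mul (norm_coeff_le f n)
              (pow_le_one₀ r.2 hr1) (pow_nonneg r.2 n) (norm_nonneg _)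
          _ = ‖f‖ := mul_one _
      · have hy' : y ∈ ball (0 : ℂ) 1 := by
          simpa [← enorm_eq_nnnorm, ← ofReal_norm] using hy
        simpa [diskFun, FormalMultilinearSeries.ofScalars_apply_eq, mul_comm] using
          (summable_diskFun f hy').hasSum
    have h0 : diskFun f =ᶠ[𝓝 0] 0 := by
      filter_upwards [ball_mem_nhds (0 : ℂ) one_pos] with z hz using hf z hz
    have := (hps.hasFPowerSeriesAt.congr h0).eq_zero
    intro n
    have h1 : FormalMultilinearSeries.coeff (FormalMultilinearSeries.ofScalars ℂ
        fun n : ℕ => fourierCoeff (f : CircleL2) (n : ℤ)) n = 0 := by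
      rw [this]
      simp [FormalMultilinearSeries.coeff]
    simpa [FormalMultilinearSeries.coeff_ofScalars] using h1
  have hrepr : fourierBasis.repr (f : CircleL2) = 0 := by
    ext n
    rw [fourierBasis_repr]
    rcases lt_or_ge n 0 with hn | hn
    · simpa using f.2 n hn
    · lift n to ℕ using hn
      simpa using hcoeff n
  exact Subtype.ext (by simpa using hrepr)

/-! ### Bounded, outer and Smirnov functions -/

/-- `f` has the radial limit `c` at the boundary point `exp (iθ)`. -/
def HasRadialLimit (f : ℂ → ℂ) (θ : ℝ) (c : ℂ) : Prop :=
  Tendsto (fun r : ℝ => f (r * Complex.exp (θ * Complex.I))) (𝓝[<] 1) (𝓝 c)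

/-- Membership in `H^∞`; only the values on the open unit disk matter. -/
def IsHInfty (f : ℂ → ℂ) : Prop :=
  DifferentiableOn ℂ f (ball 0 1) ∧ ∃ C : ℝ, ∀ z ∈ ball (0 : ℂ) 1, ‖f z‖ ≤ C

/-- Outer functions: `f(z) = α exp ((1/2π) ∫₀^{2π} (e^{iθ} + z)/(e^{iθ} - z) k(θ) dθ)` on the disk,
with `|α| = 1` and a real integrable function `k` (so that `k = log |f|` on the circle). -/
def IsOuter (f : ℂ → ℂ) : Prop :=
  ∃ (α : ℂ) (k : ℝ → ℝ), ‖α‖ = 1 ∧ IntervalIntegrable k volume 0 (2 * Real.pi) ∧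
    ∀ z ∈ ball (0 : ℂ) 1, f z = α * Complex.exp ((1 / (2 * Real.pi) : ℂ) *
      ∫ θ in (0 : ℝ)..(2 * Real.pi),
        (Complex.exp (θ * Complex.I) + z) / (Complex.exp (θ * Complex.I) - z) * (k θ : ℂ))

/-- The Smirnov class `N⁺`: quotients of bounded analytic functions with outer denominator. -/
def IsSmirnov (g : ℂ → ℂ) : Prop :=
  ∃ u v : ℂ → ℂ, IsHInfty u ∧ IsHInfty v ∧ IsOuter v ∧ ∀ z ∈ ball (0 : ℂ) 1, g z = u z / v z

/-- The class `N⁺_ℝ` of Smirnov functions with real boundary values almost everywhere. -/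
def IsRealSmirnov (g : ℂ → ℂ) : Prop :=
  IsSmirnov g ∧ ∀ᵐ θ : ℝ, ∃ x : ℝ, HasRadialLimit g θ x

/-! ### Unbounded Toeplitz operators -/

/-- The canonical representation `g = b / a` of a Smirnov function: `a, b ∈ H^∞`, `a` is outer,
`a(0) > 0` and `|a|² + |b|² = 1` almost everywhere on the circle. -/
structure IsCanonicalPair (g a b : ℂ → ℂ) : Prop where
  bounded_a : IsHInfty a
  bounded_b : IsHInfty b
  outer : IsOuter a
  pos_re : 0 < (a 0).re
  im_eq : (a 0).im = 0
  unit : ∀ᵐ θ : ℝ, ∃ α β : ℂ, HasRadialLimit a θ α ∧ HasRadialLimit b θ β ∧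
    ‖α‖ ^ 2 + ‖β‖ ^ 2 = 1
  eq_div : ∀ z ∈ ball (0 : ℂ) 1, g z = b z / a z

open Classical in
/-- The denominator `a` of the canonical representation of `g`. It exists and is unique on the disk
when `g` is a Smirnov function; the value is `0` if there is no such representation. -/
noncomputable def canonicalDenominator (g : ℂ → ℂ) : ℂ → ℂ :=
  if h : ∃ a b : ℂ → ℂ, IsCanonicalPair g a b then h.choose else fun _ => 0

/-- The graph `{(f, g f) : f ∈ a H²}`, with `a` the canonical denominator of `g`. -/
noncomputable def toeplitzGraph (g : ℂ → ℂ) : Submodule ℂ (H2 × H2) where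
  carrier := {p | (∃ u : H2, ∀ z ∈ ball (0 : ℂ) 1,
      diskFun p.1 z = canonicalDenominator g z * diskFun u z) ∧
    ∀ z ∈ ball (0 : ℂ) 1, diskFun p.2 z = g z * diskFun p.1 z}
  zero_mem' := ⟨⟨0, fun z _ => by simp [diskFun_zero]⟩, fun z _ => by simp [diskFun_zero]⟩
  add_mem' := by
    rintro p q ⟨⟨u, hu⟩, hp⟩ ⟨⟨v, hv⟩, hq⟩
    refine ⟨⟨u + v, fun z hz => ?_⟩, fun z hz => ?_⟩
    · rw [Prod.fst_add, diskFun_add _ _ hz, diskFun_add _ _ hz, hu z hz, hv z hz]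
      ring
    · rw [Prod.fst_add, Prod.snd_add, diskFun_add _ _ hz, diskFun_add _ _ hz, hp z hz, hq z hz]
      ring
  smul_mem' := by
    rintro c p ⟨⟨u, hu⟩, hp⟩
    refine ⟨⟨c • u, fun z hz => ?_⟩, fun z hz => ?_⟩
    · rw [Prod.smul_fst, diskFun_smul, diskFun_smul, hu z hz]
      ring
    · rw [Prod.smul_fst, Prod.smul_snd, diskFun_smul, diskFun_smul, hp z hz]
      ring

/-- The Toeplitz operator `T_g f = g f` with domain `a H²`. -/
noncomputable def toeplitz (g : ℂ → ℂ) : H2 →ₗ.[ℂ] H2 := (toeplitzGraph g).toLinearPMap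

theorem toeplitz_graph (g : ℂ → ℂ) : (toeplitz g).graph = toeplitzGraph g := by
  refine Submodule.toLinearPMap_graph_eq _ fun p hp h0 => ?_
  refine eq_zero_of_diskFun _ fun z hz => ?_
  rw [hp.2 z hz, h0, diskFun_zero, mul_zero]

/-! ### Simple symmetric operators and unitary equivalence -/

section Operators

variable {H : Type*} [NormedAddCommGroup H] [InnerProductSpace ℂ H]

/-- The range of `T - z I`. -/
def rangeSub (T : H →ₗ.[ℂ] H) (z : ℂ) : Submodule ℂ H :=
  LinearMap.range (T.toFun - z • T.domain.subtype)

/-- The class `𝒮_n(H)`: simple, closed, symmetric, densely defined operators with deficiency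
indices `(n, n)`. -/
structure IsSimpleSymmetric (n : ℕ∞) (T : H →ₗ.[ℂ] H) : Prop where
  dense : Dense (T.domain : Set H)
  symmetric : ∀ x y : T.domain, inner ℂ (T x) (y : H) = inner ℂ (x : H) (T y)
  simple : ⨅ (z : ℂ) (_ : z.im ≠ 0), rangeSub T z = ⊥
  closed : T.IsClosed
  index_upper : Cardinal.toENat (Module.rank ℂ (rangeSub T Complex.I)ᗮ) = n
  index_lower : Cardinal.toENat (Module.rank ℂ (rangeSub T (-Complex.I))ᗮ) = n

/-- Unitary equivalence: some unitary `U` maps the domain of `S` onto that of `T`, and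
`U S = T U` there. -/
def UnitarilyEquivalent {K : Type*} [NormedAddCommGroup K] [InnerProductSpace ℂ K]
    (S : H →ₗ.[ℂ] H) (T : K →ₗ.[ℂ] K) : Prop :=
  ∃ U : H ≃ₗᵢ[ℂ] K, (∀ x : H, x ∈ S.domain ↔ U x ∈ T.domain) ∧
    ∀ (x : S.domain) (y : T.domain), (y : K) = U x → T y = U (S x)

end Operators

/-- Disk automorphisms: analytic bijections of the open unit disk onto itself. -/
def IsDiskAutomorphism (w : ℂ → ℂ) : Prop :=
  DifferentiableOn ℂ w (ball 0 1) ∧ Set.BijOn w (ball 0 1) (ball 0 1)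

end HardyToeplitz

namespace HardyToeplitz

open scoped ComplexConjugate InnerProductSpace

/-! ### The basis of monomials, the shift and the Szegő kernel -/

/-! Szegő kernels turn a statement about operators into one about points of the disk. Every function
in the range of `T_g - g(z)` vanishes at `z`, so `k_z` lies in the deficiency space there.
Conversely, the range of `T_g - μ` is invariant under the shift, so a one-dimensional orthogonal
complement is spanned by an eigenvector of the backward shift, that is, by some `k_w`; density of
the domain then forces `g(w) = μ` (`exists_szego_of_deficiency`).

Let `U` intertwine `T_g` and `T_h`. It carries deficiency spaces to deficiency spaces, and those of
`T_h` stay at most one-dimensional near `i`. Hence `U k_z = c(z) k_{w(z)}` with `h(w(z)) = g(z)` for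
all `z` with `g(z)` near `i`. Comparing Gram matrices of kernels shows that `w` is the restriction
of a disk automorphism (`exists_isDiskAutomorphism_of_szego`), and the identity theorem extends `g =
h ∘ w` to the whole disk.

For the converse, a disk automorphism `w` gives a unitary operator `f ↦ m · (f ∘ w)`, which turns
multiplication by `h` into multiplication by `g`. The domains `aH²` also have to match. For
operators of class `𝒮₁` they are the maximal domains `{f : gf ∈ H²}` (`mem_toeplitzGraph_iff`), a
description that composition with `w` visibly respects. -/

theorem isClosed_H2 : IsClosed (H2 : Set CircleL2) := by
  have : (H2 : Set CircleL2) = ⋂ (n : ℤ) (_ : n < 0), {f : CircleL2 | fourierCoeff f n = 0} := by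
    ext f
    simp [H2]
  rw [this]
  refine isClosed_iInter fun n => isClosed_iInter fun _ => isClosed_eq ?_ continuous_const
  simp only [← fourierBasis_repr, HilbertBasis.repr_apply_apply]
  fun_prop

instance : CompleteSpace H2 := isClosed_H2.completeSpace_coe

theorem inner_smul_left_H2 (c : ℂ) (f g : H2) : ⟪c • f, g⟫_ℂ = conj c * ⟪f, g⟫_ℂ :=
  inner_smul_left f g c

theorem inner_smul_right_H2 (c : ℂ) (f g : H2) : ⟪f, c • g⟫_ℂ = c * ⟪f, g⟫_ℂ :=
  inner_smul_right f g c

/-- The monomial `z ^ n` as an element of `H²`. -/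
noncomputable def monomialH2 (n : ℕ) : H2 :=
  ⟨fourierBasis (T := (1 : ℝ)) (n : ℤ), fun m hm => by
    rw [← fourierBasis_repr, HilbertBasis.repr_apply_apply]
    exact fourierBasis.orthonormal.2 (by omega)⟩

theorem inner_monomialH2 (n : ℕ) (f : H2) :
    ⟪monomialH2 n, f⟫_ℂ = fourierCoeff (f : CircleL2) (n : ℤ) := by
  rw [← fourierBasis_repr, HilbertBasis.repr_apply_apply]
  rfl

theorem orthonormal_monomialH2 : Orthonormal ℂ monomialH2 := by
  have h := (fourierBasis (T := (1 : ℝ))).orthonormal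
  refine ⟨fun n => h.1 n, fun n m hnm => ?_⟩
  exact h.2 (i := (n : ℤ)) (j := (m : ℤ)) (by exact_mod_cast hnm)

theorem eq_zero_of_inner_monomialH2 (f : H2) (hf : ∀ n, ⟪monomialH2 n, f⟫_ℂ = 0) : f = 0 := by
  refine eq_zero_of_diskFun f fun z _ => ?_
  simp [diskFun, ← inner_monomialH2, hf]

/-- The Hilbert basis of monomials of `H²`. -/
noncomputable def basisH2 : HilbertBasis ℕ ℂ H2 :=
  HilbertBasis.mkOfOrthogonalEqBot orthonormal_monomialH2 <| by
    refine (Submodule.eq_bot_iff _).2 fun f hf => eq_zero_of_inner_monomialH2 f fun n => ?_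
    exact (Submodule.mem_orthogonal _ _).1 hf _ (Submodule.subset_span ⟨n, rfl⟩)

theorem coe_basisH2 : ⇑basisH2 = monomialH2 := HilbertBasis.coe_mkOfOrthogonalEqBot _ _

theorem fourierCoeff_basisH2_symm (a : lp (fun _ : ℕ => ℂ) 2) (n : ℕ) :
    fourierCoeff ((basisH2.repr.symm a : H2) : CircleL2) (n : ℤ) = a n := by
  rw [← inner_monomialH2, ← coe_basisH2, ← HilbertBasis.repr_apply_apply]
  simp

theorem memℓp_pow {z : ℂ} (hz : ‖z‖ < 1) : Memℓp (fun n : ℕ => z ^ n) 2 := by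
  refine memℓp_gen ?_
  have : ∀ n : ℕ, ‖z ^ n‖ ^ (2 : ENNReal).toReal = (‖z‖ ^ 2) ^ n := fun n => by
    simp [← pow_mul, mul_comm]
  simp only [this]
  exact summable_geometric_of_lt_one (by positivity) (by nlinarith [norm_nonneg z])

open Classical in
/-- The Szegő kernel `k_z`, the reproducing kernel of `H²` at `z`. -/
noncomputable def szego (z : ℂ) : H2 :=
  if h : ‖conj z‖ < 1 then basisH2.repr.symm ⟨fun n => (conj z) ^ n, memℓp_pow h⟩ else 0

theorem fourierCoeff_szego {z : ℂ} (hz : z ∈ ball (0 : ℂ) 1) (n : ℕ) :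
    fourierCoeff (szego z : CircleL2) (n : ℤ) = conj z ^ n := by
  have hz' : ‖conj z‖ < 1 := by simpa using hz
  rw [szego, dif_pos hz', fourierCoeff_basisH2_symm]

theorem inner_szego {z : ℂ} (hz : z ∈ ball (0 : ℂ) 1) (f : H2) :
    ⟪szego z, f⟫_ℂ = diskFun f z := by
  rw [← basisH2.tsum_inner_mul_inner, diskFun]
  refine tsum_congr fun n => ?_
  rw [coe_basisH2, inner_monomialH2, ← inner_conj_symm, inner_monomialH2, fourierCoeff_szego hz]
  simp [mul_comm]

theorem diskFun_szego {z ζ : ℂ} (hz : z ∈ ball (0 : ℂ) 1) (hζ : ζ ∈ ball (0 : ℂ) 1) :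
    diskFun (szego ζ) z = (1 - conj ζ * z)⁻¹ := by
  rw [diskFun, ← tsum_geometric_of_norm_lt_one]
  · simp only [fourierCoeff_szego hζ, mul_pow]
  · have h1 : ‖z‖ < 1 := by simpa using hz
    have h2 : ‖ζ‖ < 1 := by simpa using hζ
    rw [norm_mul, RCLike.norm_conj]
    nlinarith [norm_nonneg z, norm_nonneg ζ]

theorem one_sub_conj_mul_ne_zero {z ζ : ℂ} (hz : z ∈ ball (0 : ℂ) 1) (hζ : ζ ∈ ball (0 : ℂ) 1) :
    1 - conj ζ * z ≠ 0 := by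
  have h1 : ‖z‖ < 1 := by simpa using hz
  have h2 : ‖ζ‖ < 1 := by simpa using hζ
  intro h
  have h3 : ‖conj ζ * z‖ = 1 := by rw [← sub_eq_zero.1 h, norm_one]
  rw [norm_mul, RCLike.norm_conj] at h3
  nlinarith [norm_nonneg z, norm_nonneg ζ]

theorem szego_ne_zero {z : ℂ} (hz : z ∈ ball (0 : ℂ) 1) : szego z ≠ 0 := by
  intro h
  have := diskFun_szego hz hz
  rw [h, diskFun_zero] at this
  exact inv_ne_zero (one_sub_conj_mul_ne_zero hz hz) this.symm

theorem analyticOnNhd_diskFun (f : H2) : AnalyticOnNhd ℂ (diskFun f) (ball 0 1) := by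
  refine DifferentiableOn.analyticOnNhd ?_ isOpen_ball
  intro z hz
  have hz' : ‖z‖ < 1 := by simpa using hz
  obtain ⟨r, hzr, hr⟩ := exists_between hz'
  have hr0 : 0 ≤ r := (norm_nonneg z).trans hzr.le
  have : DifferentiableOn ℂ (diskFun f) (ball 0 r) := by
    refine Complex.differentiableOn_tsum_of_summable_norm (u := fun n : ℕ => ‖f‖ * r ^ n)
      ((summable_geometric_of_lt_one hr0 hr).mul_left _) (fun n => by fun_prop) isOpen_ball ?_
    intro n y hy
    have hy' : ‖y‖ < r := by simpa using hy
    rw [norm_mul, norm_pow]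
    gcongr
    exact norm_coeff_le f n
  exact (this.differentiableAt (isOpen_ball.mem_nhds (by simpa using hzr))).differentiableWithinAt

theorem diskFun_sub (f g : H2) {z : ℂ} (hz : z ∈ ball (0 : ℂ) 1) :
    diskFun (f - g) z = diskFun f z - diskFun g z := by
  rw [← inner_szego hz, ← inner_szego hz, ← inner_szego hz, inner_sub_right]

theorem ext_diskFun {f g : H2} (h : ∀ z ∈ ball (0 : ℂ) 1, diskFun f z = diskFun g z) : f = g :=
  sub_eq_zero.1 <| eq_zero_of_diskFun _ fun z hz => by rw [diskFun_sub _ _ hz, h z hz, sub_self]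

/-- The shift: multiplication by `z` on `H²`. -/
theorem exists_shift : ∃ S : H2 →L[ℂ] H2, (∀ n, S (monomialH2 n) = monomialH2 (n + 1)) ∧
    ∀ f, ∀ z ∈ ball (0 : ℂ) 1, diskFun (S f) z = z * diskFun f z := by
  have hinj : Function.Injective (fun n : ℕ => n + 1) := add_left_injective 1
  let L : lp (fun _ : ℕ => ℂ) 2 →ₗᵢ[ℂ] H2 :=
    (orthonormal_monomialH2.comp _ hinj).orthogonalFamily.linearIsometry
  have hL : ∀ n, L (lp.single 2 n 1) = monomialH2 (n + 1) := fun n => by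
    have h := OrthogonalFamily.linearIsometry_apply_single
      (orthonormal_monomialH2.comp _ hinj).orthogonalFamily (i := n) (1 : ℂ)
    exact h.trans (by simp)
  let S : H2 →ₗᵢ[ℂ] H2 := L.comp basisH2.repr.toLinearIsometry
  have hS : ∀ n, S (monomialH2 n) = monomialH2 (n + 1) := fun n => by
    have h : basisH2.repr (monomialH2 n) = lp.single 2 n 1 := by
      rw [← coe_basisH2, HilbertBasis.repr_self]
    rw [← hL, ← h]
    rfl
  refine ⟨S.toContinuousLinearMap, hS, fun f z hz => ?_⟩
  have hD : Dense ((Submodule.span ℂ (Set.range monomialH2) : Submodule ℂ H2) : Set H2) := by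
    rw [Submodule.dense_iff_topologicalClosure_eq_top, ← coe_basisH2]
    exact basisH2.dense_span
  have hmon : ∀ n, diskFun (monomialH2 n) z = z ^ n := fun n => by
    rw [diskFun, tsum_eq_single n]
    · rw [← inner_monomialH2, orthonormal_iff_ite.1 orthonormal_monomialH2, if_pos rfl, one_mul]
    · intro m hm
      rw [← inner_monomialH2, orthonormal_monomialH2.2 hm, zero_mul]
  -- Both sides are continuous functionals of `f`, so it is enough to compare them on monomials.
  have : (innerSL ℂ (szego z)).comp S.toContinuousLinearMap = z • innerSL ℂ (szego z) := by
    refine ContinuousLinearMap.ext_on hD ?_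
    rintro _ ⟨n, rfl⟩
    simp only [ContinuousLinearMap.comp_apply, innerSL_apply_apply, smul_apply,
      LinearIsometry.coe_toContinuousLinearMap, hS, inner_szego hz, hmon, smul_eq_mul]
    ring
  have h2 := congrArg (fun A : H2 →L[ℂ] ℂ => A f) this
  simpa [inner_szego hz] using h2

/-! ### Deficiency spaces of symmetric operators -/

section Operators

variable {H : Type*} [NormedAddCommGroup H] [InnerProductSpace ℂ H]

theorem mem_rangeSub_iff {T : H →ₗ.[ℂ] H} {z : ℂ} {f : H} :
    f ∈ rangeSub T z ↔ ∃ p ∈ T.graph, p.2 - z • p.1 = f := by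
  constructor
  · rintro ⟨x, rfl⟩
    exact ⟨(x, T x), T.mem_graph x, rfl⟩
  · rintro ⟨p, hp, rfl⟩
    obtain ⟨x, h1, h2⟩ := (LinearPMap.mem_graph_iff T).1 hp
    refine ⟨x, ?_⟩
    rw [← h1, ← h2]
    rfl

/-- Symmetry makes `⟪Tx, x⟫` real, so the cross term drops out and `‖Tx - ix‖² = ‖Tx‖² + ‖x‖²`. -/
theorem norm_fst_le_of_symmetric {T : H →ₗ.[ℂ] H}
    (hT : ∀ x y : T.domain, inner ℂ (T x) (y : H) = inner ℂ (x : H) (T y))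
    {p : H × H} (hp : p ∈ T.graph) :
    ‖p.1‖ ≤ ‖p.2 - Complex.I • p.1‖ ∧ ‖p.2‖ ≤ ‖p.2 - Complex.I • p.1‖ := by
  obtain ⟨x, h1, h2⟩ := (LinearPMap.mem_graph_iff T).1 hp
  rw [← h1, ← h2]
  have him : (⟪T x, (x : H)⟫_ℂ).im = 0 := by
    have h := inner_conj_symm (𝕜 := ℂ) (T x) (x : H)
    rw [← hT x x] at h
    exact Complex.conj_eq_iff_im.1 h
  have hsq : ‖T x - Complex.I • (x : H)‖ ^ 2 = ‖T x‖ ^ 2 + ‖(x : H)‖ ^ 2 := by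
    rw [norm_sub_sq (𝕜 := ℂ), inner_smul_right, norm_smul]
    simp [him]
  constructor <;> refine le_of_sq_le_sq ?_ (norm_nonneg _) <;> rw [hsq] <;>
    nlinarith [sq_nonneg ‖T x‖, sq_nonneg ‖(x : H)‖]

/-- The map `(x, Tx) ↦ Tx - ix` is bounded below on the graph, which is complete because `T` is
closed. -/
theorem isClosed_rangeSub_I [CompleteSpace H] {T : H →ₗ.[ℂ] H}
    (hT : ∀ x y : T.domain, inner ℂ (T x) (y : H) = inner ℂ (x : H) (T y)) (hc : T.IsClosed) :
    IsClosed (rangeSub T Complex.I : Set H) := by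
  have : CompleteSpace T.graph := hc.completeSpace_coe
  let L : T.graph →L[ℂ] H := (ContinuousLinearMap.snd ℂ H H -
    Complex.I • ContinuousLinearMap.fst ℂ H H).comp T.graph.subtypeL
  have hL : AntilipschitzWith 1 L := by
    refine AddMonoidHomClass.antilipschitz_of_bound L fun p => ?_
    have h := norm_fst_le_of_symmetric hT p.2
    rw [NNReal.coe_one, one_mul]
    exact max_le h.1 h.2
  have hr : (rangeSub T Complex.I : Set H) = Set.range L := by
    ext f
    rw [SetLike.mem_coe, mem_rangeSub_iff]
    exact ⟨fun ⟨p, hp, h⟩ => ⟨⟨p, hp⟩, h⟩, fun ⟨p, h⟩ => ⟨p, p.2, h⟩⟩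
  rw [hr]
  exact hL.isClosed_range L.uniformContinuous

theorem exists_generator_of_toENat_rank_eq_one {V : Submodule ℂ H}
    (hV : Cardinal.toENat (Module.rank ℂ V) = 1) :
    ∃ y ∈ V, y ≠ 0 ∧ ∀ x ∈ V, ∃ c : ℂ, x = c • y := by
  obtain ⟨y, hy, h⟩ := rank_eq_one_iff.1 (Cardinal.toENat_eq_one.1 hV)
  refine ⟨y, y.2, fun h0 => hy (Subtype.ext h0), fun x hx => ?_⟩
  obtain ⟨c, hc⟩ := h ⟨x, hx⟩
  exact ⟨c, by simpa using congrArg Subtype.val hc.symm⟩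

/-- Near `i` the deficiency space of an operator of class `𝒮₁` stays at most one-dimensional. -/
theorem IsSimpleSymmetric.eq_smul_of_mem_orthogonal [CompleteSpace H]
    {T : H →ₗ.[ℂ] H} (hT : IsSimpleSymmetric 1 T) {z : ℂ} (hz : ‖z - Complex.I‖ < 1) {y₁ y₂ : H} (h1 : y₁ ∈ (rangeSub T z)ᗮ) (h0 : y₁ ≠ 0)
    (h2 : y₂ ∈ (rangeSub T z)ᗮ) : ∃ c : ℂ, y₂ = c • y₁ := by
  obtain ⟨k, hk, -, hgen⟩ := exists_generator_of_toENat_rank_eq_one hT.index_upper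
  -- Perturbation from `i`: a vector `y` orthogonal to `k` has the form `(T - i)x` with `‖x‖ ≤ ‖y‖`.
  -- Orthogonality to `(T - z)x` then gives `‖y‖² ≤ ‖z - i‖ ‖y‖²`, which is impossible for `y ≠ 0`.
  have key : ∀ y ∈ (rangeSub T z)ᗮ, ⟪k, y⟫_ℂ = 0 → y = 0 := by
    intro y hy hky
    have hmem : y ∈ rangeSub T Complex.I := by
      have hcl := (isClosed_rangeSub_I hT.symmetric hT.closed).submodule_topologicalClosure_eq
      rw [← hcl, ← Submodule.orthogonal_orthogonal_eq_closure]
      refine (Submodule.mem_orthogonal _ _).2 fun u hu => ?_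
      obtain ⟨c, rfl⟩ := hgen u hu
      rw [inner_smul_left, hky, mul_zero]
    obtain ⟨p, hp, rfl⟩ := mem_rangeSub_iff.1 hmem
    set y := p.2 - Complex.I • p.1 with hy_def
    have hle := (norm_fst_le_of_symmetric hT.symmetric hp).1
    have horth := (Submodule.mem_orthogonal _ _).1 hy _ (mem_rangeSub_iff.2 ⟨p, hp, rfl⟩)
    have hdec : p.2 - z • p.1 = y - (z - Complex.I) • p.1 := by
      rw [hy_def, sub_smul]
      abel
    rw [hdec, inner_sub_left, sub_eq_zero, inner_self_eq_norm_sq_to_K] at horth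
    by_contra hne
    have hpos : 0 < ‖y‖ := norm_pos_iff.2 hne
    have h3 : ‖y‖ ^ 2 ≤ ‖z - Complex.I‖ * ‖p.1‖ * ‖y‖ := by
      have := norm_inner_le_norm (𝕜 := ℂ) ((z - Complex.I) • p.1) y
      rw [← horth, norm_smul] at this
      simpa using this
    have h4 : ‖z - Complex.I‖ * ‖p.1‖ ≤ ‖z - Complex.I‖ * ‖y‖ :=
      mul_le_mul_of_nonneg_left hle (norm_nonneg _)
    nlinarith [mul_pos hpos hpos]
  have hα : ⟪k, y₁⟫_ℂ ≠ 0 := fun h => h0 (key y₁ h1 h)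
  refine ⟨⟪k, y₂⟫_ℂ / ⟪k, y₁⟫_ℂ, ?_⟩
  rw [← sub_eq_zero]
  refine key _ (Submodule.sub_mem _ h2 (Submodule.smul_mem _ _ h1)) ?_
  rw [inner_sub_right, inner_smul_right]
  field_simp
  ring

end Operators

/-! ### Deficiency spaces of Toeplitz operators -/

/-- A vector spanning the orthogonal complement of a shift-invariant subspace is a multiple of a
Szegő kernel. -/
theorem exists_eq_smul_szego {N : Submodule ℂ H2}
    (hN : ∀ f ∈ N, ∀ F : H2, (∀ z ∈ ball (0 : ℂ) 1, diskFun F z = z * diskFun f z) → F ∈ N)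
    {y : H2} (hy : y ∈ Nᗮ) (h0 : y ≠ 0) (hspan : ∀ x ∈ Nᗮ, ∃ c : ℂ, x = c • y) :
    ∃ w ∈ ball (0 : ℂ) 1, ∃ c : ℂ, y = c • szego w := by
  obtain ⟨S, hS, hSz⟩ := exists_shift
  -- The adjoint of the shift preserves the complement of `N`, so `y` is an eigenvector and its
  -- coefficients form a geometric sequence.
  obtain ⟨ν, hν⟩ := hspan (ContinuousLinearMap.adjoint S y) <| by
    refine (Submodule.mem_orthogonal _ _).2 fun f hf => ?_
    rw [ContinuousLinearMap.adjoint_inner_right]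
    exact (Submodule.mem_orthogonal _ _).1 hy _ (hN f hf _ (hSz f))
  have hcoeff : ∀ n, ⟪monomialH2 n, y⟫_ℂ = ν ^ n * ⟪monomialH2 0, y⟫_ℂ := by
    intro n
    induction n with
    | zero => simp
    | succ n ih =>
      rw [← hS, ← ContinuousLinearMap.adjoint_inner_right, hν, inner_smul_right_H2, ih, pow_succ]
      ring
  have hy0 : ⟪monomialH2 0, y⟫_ℂ ≠ 0 := fun h =>
    h0 <| eq_zero_of_inner_monomialH2 y fun n => by rw [hcoeff, h, mul_zero]
  -- Otherwise the coefficients would not be square summable.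
  have hν1 : ‖ν‖ < 1 := by
    by_contra! hge
    have hlim := (orthonormal_monomialH2.inner_products_summable y).tendsto_atTop_zero
    have hpos : 0 < ‖⟪monomialH2 0, y⟫_ℂ‖ ^ 2 := by positivity
    refine absurd (ge_of_tendsto' hlim fun n => ?_) (not_le.2 hpos)
    rw [hcoeff n, norm_mul, norm_pow]
    gcongr
    exact le_mul_of_one_le_left (norm_nonneg _) (one_le_pow₀ hge)
  have hw : conj ν ∈ ball (0 : ℂ) 1 := by simpa using hν1
  refine ⟨conj ν, hw, ⟪monomialH2 0, y⟫_ℂ, ?_⟩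
  rw [← sub_eq_zero]
  refine eq_zero_of_inner_monomialH2 _ fun n => ?_
  rw [inner_sub_right, inner_smul_right_H2, inner_monomialH2 n (szego _), fourierCoeff_szego hw,
    hcoeff, Complex.conj_conj]
  ring

theorem toeplitzGraph_shift {g : ℂ → ℂ} {p q : H2 × H2} (hp : p ∈ toeplitzGraph g)
    (h1 : ∀ z ∈ ball (0 : ℂ) 1, diskFun q.1 z = z * diskFun p.1 z)
    (h2 : ∀ z ∈ ball (0 : ℂ) 1, diskFun q.2 z = z * diskFun p.2 z) : q ∈ toeplitzGraph g := by
  obtain ⟨⟨u, hu⟩, hg⟩ := hp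
  obtain ⟨S, -, hS⟩ := exists_shift
  refine ⟨⟨S u, fun z hz => ?_⟩, fun z hz => ?_⟩
  · rw [h1 z hz, hu z hz, hS u z hz]
    ring
  · rw [h1 z hz, h2 z hz, hg z hz]
    ring

theorem szego_mem_orthogonal (g : ℂ → ℂ) {z : ℂ} (hz : z ∈ ball (0 : ℂ) 1) :
    szego z ∈ (rangeSub (toeplitz g) (g z))ᗮ := by
  refine (Submodule.mem_orthogonal' _ _).2 fun f hf => ?_
  obtain ⟨p, hp, rfl⟩ := mem_rangeSub_iff.1 hf
  rw [toeplitz_graph] at hp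
  rw [inner_szego hz, diskFun_sub _ _ hz, diskFun_smul, hp.2 z hz, sub_self]

/-- A one-dimensional deficiency space of `T_g` at `μ` is spanned by the Szegő kernel at a point
where `g` takes the value `μ`. -/
theorem exists_szego_of_deficiency {g : ℂ → ℂ} (hd : Dense ((toeplitz g).domain : Set H2)) {μ : ℂ}
    {y : H2} (hy : y ∈ (rangeSub (toeplitz g) μ)ᗮ) (h0 : y ≠ 0)
    (hspan : ∀ x ∈ (rangeSub (toeplitz g) μ)ᗮ, ∃ c : ℂ, x = c • y) :
    ∃ w ∈ ball (0 : ℂ) 1, g w = μ ∧ ∃ c : ℂ, y = c • szego w := by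
  obtain ⟨w, hw, c, hc⟩ := exists_eq_smul_szego (fun f hf F hF => by
    obtain ⟨p, hp, rfl⟩ := mem_rangeSub_iff.1 hf
    obtain ⟨S, -, hS⟩ := exists_shift
    rw [toeplitz_graph] at hp
    refine mem_rangeSub_iff.2 ⟨(S p.1, S p.2), ?_, ext_diskFun fun z hz => ?_⟩
    · rw [toeplitz_graph]
      exact toeplitzGraph_shift hp (hS p.1) (hS p.2)
    · rw [hF z hz, diskFun_sub _ _ hz, diskFun_sub _ _ hz, diskFun_smul, diskFun_smul, hS _ z hz,
        hS _ z hz]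
      ring) hy h0 hspan
  refine ⟨w, hw, ?_, c, hc⟩
  have hc0 : c ≠ 0 := by
    rintro rfl
    exact h0 (by rw [hc, zero_smul])
  -- If the whole domain vanished at `w`, the kernel `k_w` would be orthogonal to a dense set.
  have hx : ∃ x ∈ (toeplitz g).domain, diskFun x w ≠ 0 := by
    by_contra! h
    refine szego_ne_zero hw (hd.eq_zero_of_inner_left ℂ fun x hx => ?_)
    rw [inner_szego hw]
    exact h x hx
  obtain ⟨x, hx, hxw⟩ := hx
  have hp := (toeplitz g).mem_graph ⟨x, hx⟩
  have horth := (Submodule.mem_orthogonal' _ _).1 hy _ (mem_rangeSub_iff.2 ⟨_, hp, rfl⟩)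
  rw [toeplitz_graph] at hp
  rw [hc, inner_smul_left_H2, inner_szego hw, diskFun_sub _ _ hw, diskFun_smul, hp.2 w hw,
    mul_eq_zero, ← sub_mul, mul_eq_zero] at horth
  rcases horth with h | h | h
  · exact absurd (by simpa using h) hc0
  · exact sub_eq_zero.1 h
  · exact absurd h hxw

/-- An outer denominator is a unimodular constant times an exponential, so it has no zeros in the
disk. -/
theorem IsSmirnov.analyticOnNhd {g : ℂ → ℂ} (hg : IsSmirnov g) :
    AnalyticOnNhd ℂ g (ball 0 1) := by
  obtain ⟨u, v, hu, hv, ⟨α, k, hα, -, hk⟩, h⟩ := hg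
  refine DifferentiableOn.analyticOnNhd ((hu.1.div hv.1 fun z hz => ?_).congr h) isOpen_ball
  rw [hk z hz]
  refine mul_ne_zero (fun h0 => ?_) (Complex.exp_ne_zero _)
  rw [h0, norm_zero] at hα
  exact zero_ne_one hα

theorem isPreconnected_unitBall : IsPreconnected (ball (0 : ℂ) 1) :=
  (convex_ball _ _).isPreconnected

/-- If `T_g` is of class `𝒮₁`, its domain is the maximal one: all `f ∈ H²` with `g f ∈ H²`. -/
theorem mem_toeplitzGraph_iff {g : ℂ → ℂ} (hg : AnalyticOnNhd ℂ g (ball 0 1))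
    (hT : IsSimpleSymmetric 1 (toeplitz g)) {p : H2 × H2} :
    p ∈ toeplitzGraph g ↔ ∀ z ∈ ball (0 : ℂ) 1, diskFun p.2 z = g z * diskFun p.1 z := by
  refine ⟨fun h => h.2, fun hp => ?_⟩
  obtain ⟨y, hy, hy0, hgen⟩ := exists_generator_of_toENat_rank_eq_one hT.index_upper
  obtain ⟨w, hw, hgw, c, rfl⟩ := exists_szego_of_deficiency hT.dense hy hy0 hgen
  obtain ⟨y', hy', hy0', hgen'⟩ := exists_generator_of_toENat_rank_eq_one hT.index_lower
  obtain ⟨w', hw', hgw', -⟩ := exists_szego_of_deficiency hT.dense hy' hy0' hgen'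
  -- This function vanishes at `w`, hence is orthogonal to the deficiency space spanned by `k_w`;
  -- the range is closed.
  have hmem : p.2 - Complex.I • p.1 ∈ rangeSub (toeplitz g) Complex.I := by
    have hcl := (isClosed_rangeSub_I hT.symmetric hT.closed).submodule_topologicalClosure_eq
    rw [← hcl, ← Submodule.orthogonal_orthogonal_eq_closure]
    refine (Submodule.mem_orthogonal _ _).2 fun u hu => ?_
    obtain ⟨d, rfl⟩ := hgen u hu
    rw [inner_smul_left_H2, inner_smul_left_H2, inner_szego hw, diskFun_sub _ _ hw, diskFun_smul,
      hp w hw, hgw, sub_self, mul_zero, mul_zero]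
  obtain ⟨q, hq, hqp⟩ := mem_rangeSub_iff.1 hmem
  rw [toeplitz_graph] at hq
  have h1 : q.1 = p.1 := by
    have hprod : ∀ z ∈ ball (0 : ℂ) 1, (g z - Complex.I) * diskFun (q.1 - p.1) z = 0 := by
      intro z hz
      have h := congrArg (fun f => diskFun f z) hqp
      simp only [diskFun_sub _ _ hz, diskFun_smul, hq.2 z hz, hp z hz] at h
      rw [diskFun_sub _ _ hz]
      linear_combination h
    rcases AnalyticOnNhd.eq_zero_or_eq_zero_of_mul_eq_zero (hg.sub analyticOnNhd_const)
      (analyticOnNhd_diskFun _) hprod isPreconnected_unitBall with h | h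
    -- The value `-i` taken at `w'` rules out `g ≡ i`.
    · have h' := h w' hw'
      simp only [Pi.sub_apply, hgw'] at h'
      have h'' := congrArg Complex.im h'
      norm_num at h''
    · exact sub_eq_zero.1 (eq_zero_of_diskFun _ h)
  have h2 : q.2 = p.2 := by
    rw [h1] at hqp
    exact sub_left_injective hqp
  rwa [← Prod.ext h1 h2]

/-! ### Disk automorphisms -/

/-- The disk automorphism `z ↦ (z - c) / (1 - c̄ z)`. -/
noncomputable def mobius (c z : ℂ) : ℂ := (z - c) / (1 - conj c * z)

/-- The transformation law of the Szegő kernel under disk automorphisms. Its diagonal case shows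
that the disk is preserved, and its off-diagonal case drives both directions of the classification.
-/
theorem one_sub_conj_mobius_mul {c z ζ : ℂ} (hc : c ∈ ball (0 : ℂ) 1) (hz : z ∈ ball (0 : ℂ) 1)
    (hζ : ζ ∈ ball (0 : ℂ) 1) :
    1 - conj (mobius c ζ) * mobius c z =
      (1 - conj c * c) * (1 - conj ζ * z) / ((1 - conj ζ * c) * (1 - conj c * z)) := by
  have h1 := one_sub_conj_mul_ne_zero hz hc
  have h2 := one_sub_conj_mul_ne_zero hc hζ
  have h3 : conj (mobius c ζ) = (conj ζ - conj c) / (1 - conj ζ * c) := by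
    simp [mobius, mul_comm]
  rw [h3, mobius]
  field_simp
  ring

theorem mobius_mem_ball {c z : ℂ} (hc : c ∈ ball (0 : ℂ) 1) (hz : z ∈ ball (0 : ℂ) 1) :
    mobius c z ∈ ball (0 : ℂ) 1 := by
  have hb : ∀ x : ℂ, 1 - conj x * x = ((1 - ‖x‖ ^ 2 : ℝ) : ℂ) := fun x => by
    rw [Complex.conj_mul']
    push_cast
    ring
  have h1 := one_sub_conj_mul_ne_zero hz hc
  have h := one_sub_conj_mobius_mul hc hz hz
  have hden : (1 - conj z * c) * (1 - conj c * z) = ((‖1 - conj c * z‖ ^ 2 : ℝ) : ℂ) := by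
    have : 1 - conj z * c = conj (1 - conj c * z) := by simp [mul_comm]
    rw [this, Complex.conj_mul']
    push_cast
    ring
  rw [hden, hb, hb, hb] at h
  have h' : 1 - ‖mobius c z‖ ^ 2 = (1 - ‖c‖ ^ 2) * (1 - ‖z‖ ^ 2) / ‖1 - conj c * z‖ ^ 2 := by
    exact_mod_cast h
  have hc' : ‖c‖ < 1 := by simpa using hc
  have hz' : ‖z‖ < 1 := by simpa using hz
  have hpos : 0 < 1 - ‖mobius c z‖ ^ 2 := by
    rw [h']
    refine div_pos (mul_pos ?_ ?_) (pow_pos (norm_pos_iff.2 h1) 2)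
    · nlinarith [norm_nonneg c]
    · nlinarith [norm_nonneg z]
  rw [mem_ball_zero_iff]
  nlinarith [norm_nonneg (mobius c z)]

theorem neg_mem_unitBall {c : ℂ} (hc : c ∈ ball (0 : ℂ) 1) : -c ∈ ball (0 : ℂ) 1 := by
  simpa using hc

theorem mobius_neg_mobius {c z : ℂ} (hc : c ∈ ball (0 : ℂ) 1) (hz : z ∈ ball (0 : ℂ) 1) :
    mobius (-c) (mobius c z) = z := by
  have h1 := one_sub_conj_mul_ne_zero hz hc
  have h2 := one_sub_conj_mul_ne_zero hc hc
  have h3 : 1 - conj (-c) * ((z - c) / (1 - conj c * z)) =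
      (1 - conj c * c) / (1 - conj c * z) := by
    rw [map_neg]
    field_simp
    ring
  have h4 : (z - c) / (1 - conj c * z) - -c = z * (1 - conj c * c) / (1 - conj c * z) := by
    rw [eq_div_iff h1, sub_mul, div_mul_cancel₀ _ h1]
    ring
  rw [mobius, mobius, h3, h4, div_div_div_cancel_right₀ h1, mul_div_cancel_right₀ _ h2]

theorem mobius_mobius_neg {c z : ℂ} (hc : c ∈ ball (0 : ℂ) 1) (hz : z ∈ ball (0 : ℂ) 1) :
    mobius c (mobius (-c) z) = z := by
  simpa using mobius_neg_mobius (neg_mem_unitBall hc) hz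

theorem isDiskAutomorphism_mobius {c : ℂ} (hc : c ∈ ball (0 : ℂ) 1) :
    IsDiskAutomorphism (mobius c) := by
  refine ⟨?_, Set.InvOn.bijOn (f' := mobius (-c)) ⟨fun z hz => mobius_neg_mobius hc hz,
    fun z hz => mobius_mobius_neg hc hz⟩ (fun z hz => mobius_mem_ball hc hz)
    fun z hz => mobius_mem_ball (neg_mem_unitBall hc) hz⟩
  unfold mobius
  exact DifferentiableOn.div (by fun_prop) (by fun_prop) fun z hz =>
    one_sub_conj_mul_ne_zero hz hc

theorem isDiskAutomorphism_mul {u : ℂ} (hu : ‖u‖ = 1) : IsDiskAutomorphism fun z => u * z := by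
  have hu0 : u ≠ 0 := fun h => by simp [h] at hu
  refine ⟨by fun_prop, Set.InvOn.bijOn (f' := fun z => u⁻¹ * z)
    ⟨fun z _ => inv_mul_cancel_left₀ hu0 z, fun z _ => mul_inv_cancel_left₀ hu0 z⟩
    (fun z hz => ?_) fun z hz => ?_⟩ <;> simpa [hu] using hz

theorem IsDiskAutomorphism.comp {v w : ℂ → ℂ} (hv : IsDiskAutomorphism v)
    (hw : IsDiskAutomorphism w) : IsDiskAutomorphism (v ∘ w) :=
  ⟨hv.1.comp hw.1 hw.2.mapsTo, hv.2.comp hw.2⟩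

/-- The inverse of an injective analytic function is analytic. -/
theorem differentiableOn_of_leftInvOn {v u : ℂ → ℂ} {s : Set ℂ} (hs : IsOpen s)
    (hs' : IsPreconnected s) (hv : DifferentiableOn ℂ v s) (huv : Set.LeftInvOn u v s) :
    DifferentiableOn ℂ u (v '' s) := by
  have ha := hv.analyticOnNhd hs
  rcases s.subsingleton_or_nontrivial with hsub | hnt
  · exact (hsub.image v).differentiableOn
  have hinj : Set.InjOn v s := huv.injOn
  have hopen : ∀ t ⊆ s, IsOpen t → IsOpen (v '' t) := by
    rcases ha.is_constant_or_isOpen hs' with ⟨c, hc⟩ | h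
    · obtain ⟨x, hx, y, hy, hxy⟩ := hnt
      exact absurd (hinj hx hy ((hc x hx).trans (hc y hy).symm)) hxy
    · exact h
  have hcont : ContinuousOn u (v '' s) := by
    refine (hopen s subset_rfl hs).continuousOn_iff.2 fun {z} hz => ?_
    rw [ContinuousAt, _root_.tendsto_nhds]
    intro t ht hzt
    refine mem_of_superset ((hopen (t ∩ s) Set.inter_subset_right (ht.inter hs)).mem_nhds ?_) ?_
    · obtain ⟨x, hx, rfl⟩ := hz
      rw [huv hx] at hzt
      exact ⟨x, ⟨hzt, hx⟩, rfl⟩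
    · rintro _ ⟨x, hx, rfl⟩
      rw [Set.mem_preimage, huv hx.2]
      exact hx.1
  have hderiv : ∀ x ∈ s, deriv v x ≠ 0 → DifferentiableAt ℂ u (v x) := by
    intro x hx h
    have hnhds := (hopen s subset_rfl hs).mem_nhds (Set.mem_image_of_mem v hx)
    have hd : HasDerivAt v (deriv v x) (u (v x)) := by
      rw [huv hx]
      exact (ha x hx).differentiableAt.hasDerivAt
    refine (HasDerivAt.of_local_left_inverse (hcont.continuousAt hnhds) hd h ?_).differentiableAt
    filter_upwards [hnhds] with z hz
    obtain ⟨y, hy, rfl⟩ := hz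
    rw [huv hy]
  rintro _ ⟨x, hx, rfl⟩
  have hnhds := (hopen s subset_rfl hs).mem_nhds (Set.mem_image_of_mem v hx)
  -- Zeros of `v'` are isolated: otherwise `v` would be constant on a ball around `x`, against
  -- injectivity.
  have hx' : ∀ᶠ y in 𝓝[≠] x, deriv v y ≠ 0 := by
    rcases (ha x hx).deriv.eventually_eq_zero_or_eventually_ne_zero with h | h
    · have h0 := ha.deriv.eqOn_zero_of_preconnected_of_eventuallyEq_zero hs' hx h
      obtain ⟨r, hr, hrs⟩ := Metric.isOpen_iff.1 hs x hx
      have hcst : ∀ y ∈ ball x r, v y = v x := fun y hy =>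
        (convex_ball x r).is_const_of_fderivWithin_eq_zero (𝕜 := ℂ) (hv.mono hrs) (fun z hz => by
          rw [fderivWithin_of_isOpen isOpen_ball hz]
          ext
          simpa using h0 (hrs hz)) hy (mem_ball_self hr)
      have hy : x + (r / 2 : ℝ) ∈ ball x r := by
        rw [mem_ball, dist_eq_norm, add_sub_cancel_left, Complex.norm_real, Real.norm_eq_abs,
          abs_of_pos (by positivity)]
        linarith
      have h3 := hinj (hrs hy) hx (hcst _ hy)
      have h4 : ((r / 2 : ℝ) : ℂ) = 0 := by simpa using h3
      have h5 : r / 2 = 0 := by exact_mod_cast h4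
      linarith
    · exact h
  have hcx : ContinuousAt u (v x) := hcont.continuousAt hnhds
  -- At a critical value the inverse is continuous, and differentiable nearby off that point, so the
  -- singularity is removable.
  refine (Complex.analyticAt_of_differentiable_on_punctured_nhds_of_continuousAt ?_
    hcx).differentiableAt.differentiableWithinAt
  have htend : Tendsto u (𝓝[≠] v x) (𝓝[≠] x) := by
    refine tendsto_nhdsWithin_iff.2 ⟨?_, ?_⟩
    · have := hcx.tendsto
      rw [huv hx] at this
      exact this.mono_left nhdsWithin_le_nhds
    · filter_upwards [nhdsWithin_le_nhds hnhds, self_mem_nhdsWithin] with z hz hne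
      obtain ⟨y, hy, rfl⟩ := hz
      rw [huv hy]
      rintro rfl
      exact hne rfl
  filter_upwards [htend.eventually hx', nhdsWithin_le_nhds hnhds] with z h1 hz
  obtain ⟨y, hy, rfl⟩ := hz
  rw [huv hy] at h1
  exact hderiv y hy h1

/-- The Schwarz lemma, applied to `v` and to its inverse, gives `‖v z‖ = ‖z‖`; its equality case,
read off at `1/2`, gives the rotation. -/
theorem IsDiskAutomorphism.eq_mul_of_map_zero {v : ℂ → ℂ} (hv : IsDiskAutomorphism v)
    (h0 : v 0 = 0) : ∃ u : ℂ, ‖u‖ = 1 ∧ ∀ z ∈ ball (0 : ℂ) 1, v z = u * z := by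
  have hz0 : (0 : ℂ) ∈ ball (0 : ℂ) 1 := mem_ball_self one_pos
  set i := Function.invFunOn v (ball 0 1)
  have hinv := hv.2.invOn_invFunOn
  have hmaps : Set.MapsTo i (ball 0 1) (ball 0 1) := hv.2.surjOn.mapsTo_invFunOn
  have hid : DifferentiableOn ℂ i (ball 0 1) := by
    have h := differentiableOn_of_leftInvOn isOpen_ball isPreconnected_unitBall hv.1
      (u := i) hinv.1
    rwa [hv.2.image_eq] at h
  have hi0 : i 0 = 0 := by
    have h : i (v 0) = 0 := hinv.1 hz0
    rwa [h0] at h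
  have hnorm : ∀ z ∈ ball (0 : ℂ) 1, ‖v z‖ = ‖z‖ := by
    intro z hz
    refine le_antisymm (Complex.norm_le_norm_of_mapsTo_ball hv.1
      (hv.2.mapsTo.mono_right ball_subset_closedBall) h0 (by simpa using hz)) ?_
    have h := Complex.norm_le_norm_of_mapsTo_ball hid (hmaps.mono_right ball_subset_closedBall) hi0
      (z := v z) (by simpa using hv.2.mapsTo hz)
    rwa [show i (v z) = z from hinv.1 hz] at h
  have hz1 : (1 / 2 : ℂ) ∈ ball (0 : ℂ) 1 := by
    rw [mem_ball_zero_iff]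
    norm_num
  obtain ⟨C, hC, hE⟩ := Complex.affine_of_mapsTo_ball_of_exists_norm_dslope_eq_div' (R₂ := 1) hv.1
    (by rw [h0]; exact hv.2.mapsTo.mono_right ball_subset_closedBall)
    ⟨1 / 2, hz1, by
      rw [dslope_of_ne _ (by norm_num), slope_def_module, norm_smul, h0, sub_zero, sub_zero,
        hnorm _ hz1]
      norm_num⟩
  refine ⟨C, by simpa using hC, fun z hz => ?_⟩
  rw [hE hz, h0]
  simp [mul_comm]

theorem IsDiskAutomorphism.exists_eq_mul_mobius {w : ℂ → ℂ} (hw : IsDiskAutomorphism w) :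
    ∃ u : ℂ, ‖u‖ = 1 ∧ ∃ d ∈ ball (0 : ℂ) 1, ∀ z ∈ ball (0 : ℂ) 1, w z = u * mobius d z := by
  obtain ⟨d, hd, hwd⟩ := hw.2.surjOn (mem_ball_self one_pos)
  obtain ⟨u, hu, h⟩ := (hw.comp (isDiskAutomorphism_mobius (neg_mem_unitBall hd))).eq_mul_of_map_zero
    (by simpa [mobius] using hwd)
  refine ⟨u, hu, d, hd, fun z hz => ?_⟩
  rw [← h _ (mobius_mem_ball hd hz), Function.comp_apply, mobius_neg_mobius hd hz]

/-! ### Weighted composition operators -/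

theorem inner_linearCombination {H ι : Type*} [NormedAddCommGroup H] [InnerProductSpace ℂ H]
    {v w : ι → H} (h : ∀ i j, ⟪v i, v j⟫_ℂ = ⟪w i, w j⟫_ℂ) (x y : ι →₀ ℂ) :
    ⟪Finsupp.linearCombination ℂ v x, Finsupp.linearCombination ℂ v y⟫_ℂ =
      ⟪Finsupp.linearCombination ℂ w x, Finsupp.linearCombination ℂ w y⟫_ℂ := by
  simp only [Finsupp.linearCombination_apply, Finsupp.sum, sum_inner, inner_sum, inner_smul_left,
    inner_smul_right, h]

/-- Two total families with the same Gram matrix are related by a unitary operator. -/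
theorem exists_linearIsometryEquiv_of_inner_eq {H ι : Type*} [NormedAddCommGroup H]
    [InnerProductSpace ℂ H] [CompleteSpace H] {v w : ι → H}
    (h : ∀ i j, ⟪v i, v j⟫_ℂ = ⟪w i, w j⟫_ℂ)
    (hv : ∀ f : H, (∀ i, ⟪v i, f⟫_ℂ = 0) → f = 0) (hw : ∀ f : H, (∀ i, ⟪w i, f⟫_ℂ = 0) → f = 0) :
    ∃ U : H ≃ₗᵢ[ℂ] H, ∀ i, U (v i) = w i := by
  have hdense : ∀ u : ι → H, (∀ f : H, (∀ i, ⟪u i, f⟫_ℂ = 0) → f = 0) →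
      DenseRange (Finsupp.linearCombination ℂ u) := fun u hu => by
    have h1 : (LinearMap.range (Finsupp.linearCombination ℂ u)).topologicalClosure = ⊤ := by
      rw [Submodule.topologicalClosure_eq_top_iff, Finsupp.range_linearCombination]
      exact (Submodule.eq_bot_iff _).2 fun f hf => hu f fun i =>
        (Submodule.mem_orthogonal _ _).1 hf _ (Submodule.subset_span ⟨i, rfl⟩)
    exact (Submodule.dense_iff_topologicalClosure_eq_top).2 h1
  have hnorm : ∀ x : ι →₀ ℂ, ‖Finsupp.linearCombination ℂ w x‖ =
      ‖Finsupp.linearCombination ℂ v x‖ := fun x => by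
    rw [norm_eq_sqrt_re_inner (𝕜 := ℂ), norm_eq_sqrt_re_inner (𝕜 := ℂ),
      inner_linearCombination h]
  refine ⟨(LinearEquiv.refl ℂ (ι →₀ ℂ)).extendOfIsometry _ _ (hdense v hv) (hdense w hw) hnorm,
    fun i => ?_⟩
  have h2 := LinearEquiv.extendOfIsometry_eq (LinearEquiv.refl ℂ (ι →₀ ℂ)) _ _ (hdense v hv)
    (hdense w hw) hnorm (Finsupp.single i 1)
  simpa using h2

/-- The unitary weighted composition operator of a disk automorphism. -/
theorem IsDiskAutomorphism.exists_unitary {w : ℂ → ℂ} (hw : IsDiskAutomorphism w) :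
    ∃ (V : H2 ≃ₗᵢ[ℂ] H2) (m : ℂ → ℂ), (∀ z ∈ ball (0 : ℂ) 1, m z ≠ 0) ∧
      ∀ f, ∀ z ∈ ball (0 : ℂ) 1, diskFun (V f) z = m z * diskFun f (w z) := by
  obtain ⟨u, hu, d, hd, hwd⟩ := hw.exists_eq_mul_mobius
  have hd' : ‖d‖ < 1 := by simpa using hd
  have hs : 0 < 1 - ‖d‖ ^ 2 := by nlinarith [norm_nonneg d]
  set s : ℝ := √(1 - ‖d‖ ^ 2)
  have hs0 : (s : ℂ) ≠ 0 := by exact_mod_cast (Real.sqrt_pos.2 hs).ne'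
  have hss : (s : ℂ) * s = 1 - conj d * d := by
    rw [Complex.conj_mul', ← Complex.ofReal_mul, Real.mul_self_sqrt hs.le]
    push_cast
    ring
  -- This weight is the normalized kernel at the zero `d` of `w`; it makes the covariance `hcov`
  -- hold exactly.
  set m : ℂ → ℂ := fun z => s / (1 - conj d * z) with hm_def
  have hm : ∀ z ∈ ball (0 : ℂ) 1, m z ≠ 0 := fun z hz =>
    div_ne_zero hs0 (one_sub_conj_mul_ne_zero hz hd)
  have huu : conj u * u = 1 := by rw [Complex.conj_mul', hu]; norm_num
  have hcov : ∀ z ∈ ball (0 : ℂ) 1, ∀ ζ ∈ ball (0 : ℂ) 1,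
      (1 - conj ζ * z)⁻¹ = m z * conj (m ζ) * (1 - conj (w ζ) * w z)⁻¹ := by
    intro z hz ζ hζ
    have h1 := one_sub_conj_mul_ne_zero hz hζ
    have h2 := one_sub_conj_mul_ne_zero hz hd
    have h3 := one_sub_conj_mul_ne_zero hd hζ
    have h4 := one_sub_conj_mul_ne_zero hd hd
    have h5 : conj (m ζ) = s / (1 - conj ζ * d) := by simp [hm_def, mul_comm]
    have h6 : 1 - conj (w ζ) * w z = s * s * (1 - conj ζ * z) /
        ((1 - conj ζ * d) * (1 - conj d * z)) := by
      rw [hss, ← one_sub_conj_mobius_mul hd hz hζ, hwd z hz, hwd ζ hζ, map_mul]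
      linear_combination -(conj (mobius d ζ) * mobius d z) * huu
    rw [h5, h6, show m z = s / (1 - conj d * z) from rfl]
    generalize 1 - conj d * z = a at h2 ⊢
    generalize 1 - conj ζ * d = b at h3 ⊢
    field_simp
  have hwm := hw.2.mapsTo
  -- The unitary is built on kernels, `k_z ↦ conj (m z) k_{w z}`, with `hcov` equating the Gram
  -- matrices. The weighted composition is its inverse.
  obtain ⟨V, hV⟩ := exists_linearIsometryEquiv_of_inner_eq
    (v := fun z : ball (0 : ℂ) 1 => szego z)
    (w := fun z : ball (0 : ℂ) 1 => conj (m z) • szego (w z)) (fun ⟨z, hz⟩ ⟨ζ, hζ⟩ => by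
      rw [inner_smul_left_H2, inner_smul_right_H2, inner_szego hz, inner_szego (hwm hz),
        diskFun_szego hz hζ, diskFun_szego (hwm hz) (hwm hζ), hcov z hz ζ hζ, Complex.conj_conj,
        mul_assoc])
    (fun f hf => eq_zero_of_diskFun f fun z hz => by
      rw [← inner_szego hz]
      exact hf ⟨z, hz⟩)
    (fun f hf => eq_zero_of_diskFun f fun z hz => by
      obtain ⟨ζ, hζ, rfl⟩ := hw.2.surjOn hz
      have h := hf ⟨ζ, hζ⟩
      rw [inner_smul_left_H2, inner_szego (hwm hζ), Complex.conj_conj] at h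
      exact (mul_eq_zero.1 h).resolve_left (hm ζ hζ))
  refine ⟨V.symm, m, hm, fun f z hz => ?_⟩
  rw [← inner_szego hz, ← V.inner_map_map, LinearIsometryEquiv.apply_symm_apply,
    show V (szego z) = conj (m z) • szego (w z) from hV ⟨z, hz⟩, inner_smul_left_H2,
    inner_szego (hwm hz), Complex.conj_conj]

/-- Graphs encode domain and action together, so one membership condition can be transported by `U`.
-/
theorem unitarilyEquivalent_iff_graph {H K : Type*} [NormedAddCommGroup H] [InnerProductSpace ℂ H]
    [NormedAddCommGroup K] [InnerProductSpace ℂ K] {S : H →ₗ.[ℂ] H} {T : K →ₗ.[ℂ] K} :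
    UnitarilyEquivalent S T ↔
      ∃ U : H ≃ₗᵢ[ℂ] K, ∀ p : H × H, p ∈ S.graph ↔ (U p.1, U p.2) ∈ T.graph := by
  constructor
  · rintro ⟨U, hdom, hact⟩
    refine ⟨U, fun p => ⟨fun hp => ?_, fun hp => ?_⟩⟩
    · obtain ⟨x, h1, h2⟩ := (LinearPMap.mem_graph_iff S).1 hp
      have hx : U p.1 ∈ T.domain := (hdom _).1 (h1 ▸ x.2)
      refine (LinearPMap.mem_graph_iff T).2 ⟨⟨U p.1, hx⟩, rfl, ?_⟩
      rw [hact x ⟨U p.1, hx⟩ (by rw [h1]), h2]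
    · obtain ⟨y, h1, h2⟩ := (LinearPMap.mem_graph_iff T).1 hp
      have hx : p.1 ∈ S.domain := (hdom _).2 (T.mem_domain_of_mem_graph hp)
      refine (LinearPMap.mem_graph_iff S).2 ⟨⟨p.1, hx⟩, rfl, U.injective ?_⟩
      rw [← hact ⟨p.1, hx⟩ y h1, h2]
  · rintro ⟨U, hU⟩
    refine ⟨U, fun x => ⟨fun hx => ?_, fun hx => ?_⟩, fun x y hxy => ?_⟩
    · exact T.mem_domain_of_mem_graph ((hU _).1 (S.mem_graph ⟨x, hx⟩))
    · have h := T.mem_graph ⟨U x, hx⟩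
      exact S.mem_domain_of_mem_graph ((hU (x, U.symm (T ⟨U x, hx⟩))).2 (by simpa using h))
    · have h := (hU _).1 (S.mem_graph x)
      exact T.mem_graph_snd_inj (T.mem_graph y) h hxy

/-! ### The classification -/

theorem unitarilyEquivalent_toeplitz_comp {g h w : ℂ → ℂ}
    (hg : AnalyticOnNhd ℂ g (ball 0 1)) (hh : AnalyticOnNhd ℂ h (ball 0 1))
    (hTg : IsSimpleSymmetric 1 (toeplitz g)) (hTh : IsSimpleSymmetric 1 (toeplitz h))
    (hw : IsDiskAutomorphism w) (hgw : ∀ z ∈ ball (0 : ℂ) 1, g z = h (w z)) :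
    UnitarilyEquivalent (toeplitz g) (toeplitz h) := by
  obtain ⟨V, m, hm, hV⟩ := hw.exists_unitary
  refine unitarilyEquivalent_iff_graph.2 ⟨V.symm, fun p => ?_⟩
  rw [toeplitz_graph, toeplitz_graph, mem_toeplitzGraph_iff hg hTg, mem_toeplitzGraph_iff hh hTh]
  have hp : ∀ f, ∀ z ∈ ball (0 : ℂ) 1, diskFun f z = m z * diskFun (V.symm f) (w z) :=
    fun f z hz => by rw [← hV _ z hz, LinearIsometryEquiv.apply_symm_apply]
  constructor
  · intro H z hz
    obtain ⟨ζ, hζ, rfl⟩ := hw.2.surjOn hz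
    have h1 := H ζ hζ
    rw [hp p.1 ζ hζ, hp p.2 ζ hζ, hgw ζ hζ] at h1
    refine mul_left_cancel₀ (hm ζ hζ) ?_
    rw [h1]
    ring
  · intro H z hz
    rw [hp p.1 z hz, hp p.2 z hz, hgw z hz, H _ (hw.2.mapsTo hz)]
    ring

/-- A map that transports the Szegő kernel up to nonzero factors is a disk automorphism. -/
theorem exists_isDiskAutomorphism_of_szego {Ω : Set ℂ} (hΩ : Ω ⊆ ball 0 1) {p ζ₁ : ℂ} (hp : p ∈ Ω)
    (hζ₁ : ζ₁ ∈ Ω) (hne : ζ₁ ≠ p) (U : H2 ≃ₗᵢ[ℂ] H2) {w c : ℂ → ℂ}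
    (hw : ∀ z ∈ Ω, w z ∈ ball (0 : ℂ) 1) (hU : ∀ z ∈ Ω, U (szego z) = c z • szego (w z)) :
    ∃ W, IsDiskAutomorphism W ∧ ∀ z ∈ Ω, w z = W z := by
  have hc : ∀ z ∈ Ω, c z ≠ 0 := fun z hz h0 => by
    have h := hU z hz
    rw [h0, zero_smul, LinearIsometryEquiv.map_eq_zero_iff] at h
    exact szego_ne_zero (hΩ hz) h
  have hker : ∀ z ∈ Ω, ∀ ζ ∈ Ω, 1 - conj (w ζ) * w z =
      conj (c z) * c ζ * (1 - conj ζ * z) := by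
    intro z hz ζ hζ
    have h := U.inner_map_map (szego z) (szego ζ)
    rw [hU z hz, hU ζ hζ, inner_smul_left_H2, inner_smul_right_H2, inner_szego (hw z hz),
      inner_szego (hΩ hz), diskFun_szego (hw z hz) (hw ζ hζ), diskFun_szego (hΩ hz) (hΩ hζ)] at h
    have h1 := one_sub_conj_mul_ne_zero (hΩ hz) (hΩ hζ)
    have h2 := one_sub_conj_mul_ne_zero (hw z hz) (hw ζ hζ)
    field_simp at h
    rw [← h]
  -- Moving `p` and `w p` to the origin divides four kernel values, and all the factors `c` cancel.
  -- No regularity of `w` or `c` is needed.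
  have hmob : ∀ z ∈ Ω, ∀ ζ ∈ Ω, conj (mobius (w p) (w ζ)) * mobius (w p) (w z) =
      conj (mobius p ζ) * mobius p z := by
    intro z hz ζ hζ
    have h1 := one_sub_conj_mobius_mul (hw p hp) (hw z hz) (hw ζ hζ)
    have h2 := one_sub_conj_mobius_mul (hΩ hp) (hΩ hz) (hΩ hζ)
    rw [hker z hz ζ hζ, hker p hp ζ hζ, hker z hz p hp, hker p hp p hp] at h1
    have h3 := hc z hz
    have h4 := hc ζ hζ
    have h5 := hc p hp
    have h6 : conj (c z) ≠ 0 := by simpa using h3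
    have h7 : conj (c p) ≠ 0 := by simpa using h5
    have h8 : conj (c p) * c p * (1 - conj p * p) * (conj (c z) * c ζ * (1 - conj ζ * z)) /
        (conj (c p) * c ζ * (1 - conj ζ * p) * (conj (c z) * c p * (1 - conj p * z))) =
        (1 - conj p * p) * (1 - conj ζ * z) / ((1 - conj ζ * p) * (1 - conj p * z)) := by
      have h9 := one_sub_conj_mul_ne_zero (hΩ hp) (hΩ hζ)
      have h10 := one_sub_conj_mul_ne_zero (hΩ hz) (hΩ hp)
      field_simp
    rw [h8, ← h2] at h1
    linear_combination -h1
  set a := mobius p ζ₁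
  set b := mobius (w p) (w ζ₁)
  have hab : ‖b‖ = ‖a‖ := by
    have h := hmob ζ₁ hζ₁ ζ₁ hζ₁
    rw [Complex.conj_mul', Complex.conj_mul'] at h
    have h' : ‖b‖ ^ 2 = ‖a‖ ^ 2 := by exact_mod_cast h
    exact (pow_left_inj₀ (norm_nonneg _) (norm_nonneg _) two_ne_zero).1 h'
  have ha : a ≠ 0 :=
    div_ne_zero (sub_ne_zero.2 hne) (one_sub_conj_mul_ne_zero (hΩ hζ₁) (hΩ hp))
  have hb : b ≠ 0 := by
    rw [← norm_ne_zero_iff, hab]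
    exact norm_ne_zero_iff.2 ha
  have hu : ‖conj a / conj b‖ = 1 := by
    rw [norm_div, RCLike.norm_conj, RCLike.norm_conj, hab, div_self (norm_ne_zero_iff.2 ha)]
  -- Fixing `ζ = ζ₁` in `hmob` makes the recentred `w` a rotation, by the unimodular factor `conj a
  -- / conj b`.
  refine ⟨mobius (-(w p)) ∘ (fun z => conj a / conj b * z) ∘ mobius p,
    (isDiskAutomorphism_mobius (neg_mem_unitBall (hw p hp))).comp
      ((isDiskAutomorphism_mul hu).comp (isDiskAutomorphism_mobius (hΩ hp))), fun z hz => ?_⟩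
  have hb' : conj b ≠ 0 := by simpa using hb
  have h : conj a / conj b * mobius p z = mobius (w p) (w z) := by
    rw [div_mul_eq_mul_div, div_eq_iff hb', ← hmob z hz ζ₁ hζ₁, mul_comm]
  rw [Function.comp_apply, Function.comp_apply, h, mobius_neg_mobius (hw p hp) (hw z hz)]

theorem exists_isDiskAutomorphism_of_unitarilyEquivalent {g h : ℂ → ℂ}
    (hg : AnalyticOnNhd ℂ g (ball 0 1)) (hh : AnalyticOnNhd ℂ h (ball 0 1))
    (hTg : IsSimpleSymmetric 1 (toeplitz g)) (hTh : IsSimpleSymmetric 1 (toeplitz h))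
    (hU : UnitarilyEquivalent (toeplitz g) (toeplitz h)) :
    ∃ w : ℂ → ℂ, IsDiskAutomorphism w ∧ ∀ z ∈ ball (0 : ℂ) 1, g z = h (w z) := by
  obtain ⟨U, hU⟩ := unitarilyEquivalent_iff_graph.1 hU
  -- On `Ω` the value `g z` lies within distance `1` of `i`, where the deficiency spaces of `T_h`
  -- are at most one-dimensional.
  set Ω : Set ℂ := ball 0 1 ∩ g ⁻¹' ball Complex.I 1
  have hΩ : Ω ⊆ ball 0 1 := Set.inter_subset_left
  have hΩo : IsOpen Ω := hg.continuousOn.isOpen_inter_preimage isOpen_ball isOpen_ball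
  obtain ⟨p, hp, hgp⟩ : ∃ p ∈ ball (0 : ℂ) 1, g p = Complex.I := by
    obtain ⟨y, hy, hy0, hgen⟩ := exists_generator_of_toENat_rank_eq_one hTg.index_upper
    obtain ⟨w, hw, hgw, -⟩ := exists_szego_of_deficiency hTg.dense hy hy0 hgen
    exact ⟨w, hw, hgw⟩
  have hpΩ : p ∈ Ω := ⟨hp, by simp [hgp]⟩
  have hex : ∀ z ∈ Ω, ∃ w ∈ ball (0 : ℂ) 1, h w = g z ∧ ∃ c : ℂ, U (szego z) = c • szego w := by
    rintro z ⟨hz, hgz⟩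
    have hmem : U (szego z) ∈ (rangeSub (toeplitz h) (g z))ᗮ := by
      refine (Submodule.mem_orthogonal _ _).2 fun f hf => ?_
      obtain ⟨q, hq, rfl⟩ := mem_rangeSub_iff.1 hf
      have hq' : (U.symm q.1, U.symm q.2) ∈ (toeplitz g).graph := (hU _).2 (by simpa using hq)
      have := (Submodule.mem_orthogonal _ _).1 (szego_mem_orthogonal g hz) _
        (mem_rangeSub_iff.2 ⟨_, hq', rfl⟩)
      rw [← U.inner_map_map] at this
      simpa using this
    have h0 : U (szego z) ≠ 0 := by
      rw [Ne, LinearIsometryEquiv.map_eq_zero_iff]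
      exact szego_ne_zero hz
    exact exists_szego_of_deficiency hTh.dense hmem h0 fun x hx =>
      hTh.eq_smul_of_mem_orthogonal (by simpa [dist_eq_norm] using hgz) hmem h0 hx
  choose! w hw hhw c hc using hex
  obtain ⟨ζ₁, hζ₁, hne⟩ : ∃ ζ ∈ Ω, ζ ≠ p := by
    have h1 : ∀ᶠ z in 𝓝[≠] p, z ∈ Ω := nhdsWithin_le_nhds (hΩo.mem_nhds hpΩ)
    obtain ⟨z, h2, h3⟩ := (h1.and self_mem_nhdsWithin).exists
    exact ⟨z, h2, h3⟩
  obtain ⟨W, hW, hwW⟩ := exists_isDiskAutomorphism_of_szego hΩ hpΩ hζ₁ hne U hw hc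
  refine ⟨W, hW, ?_⟩
  have hhW : AnalyticOnNhd ℂ (h ∘ W) (ball 0 1) :=
    hh.comp (hW.1.analyticOnNhd isOpen_ball) hW.2.mapsTo
  refine hg.eqOn_of_preconnected_of_eventuallyEq hhW isPreconnected_unitBall hp ?_
  filter_upwards [hΩo.mem_nhds hpΩ] with z hz
  exact (hwW z hz ▸ hhw z hz).symm

end HardyToeplitz

theorem mainTheorem10 (g h : ℂ → ℂ)
    (hg : HardyToeplitz.IsRealSmirnov g) (hh : HardyToeplitz.IsRealSmirnov h)
    (hTg : HardyToeplitz.IsSimpleSymmetric 1 (HardyToeplitz.toeplitz g))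
    (hTh : HardyToeplitz.IsSimpleSymmetric 1 (HardyToeplitz.toeplitz h)) :
    HardyToeplitz.UnitarilyEquivalent (HardyToeplitz.toeplitz g) (HardyToeplitz.toeplitz h) ↔
      ∃ w : ℂ → ℂ, HardyToeplitz.IsDiskAutomorphism w ∧
        ∀ z ∈ Metric.ball (0 : ℂ) 1, g z = h (w z) :=
  ⟨HardyToeplitz.exists_isDiskAutomorphism_of_unitarilyEquivalent hg.1.analyticOnNhd
    hh.1.analyticOnNhd hTg hTh, fun ⟨_, hw, hgw⟩ =>
    HardyToeplitz.unitarilyEquivalent_toeplitz_comp hg.1.analyticOnNhd hh.1.analyticOnNhd hTg hTh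
      hw hgw⟩
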